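/- Let $R$ be a hyperbolic automorphism of $\mathbb{Z}^2$, that is, an automorphism none of whose complex eigenvalues has modulus $1$, and let $G_R=\mathbb{Z}^2\rtimes_R\mathbb{Z}$ be the semidirect product in which $n\in\mathbb{Z}$ acts on $\mathbb{Z}^2$ by $R^n$. Let $\{a,b\}$ be the standard generating set of $\mathbb{Z}^2$ and $c$ the standard generator of $\mathbb{Z}$, regarded as elements of $G_R$. Then $S=\{a,b,c\}$ generates $G_R$, and $G_R$ has arbitrarily deep dead ends with respect to $S$: for every $n\in\mathbb{N}$ there is a dead end $g\in G_R$ of depth at least $n$. Here, with $d_S$ the word metric on $G_R$ with respect to $S$, the depth of $g$ is the $d_S$-distance from $g$ to the complement of the closed ball of radius $d_S(1,g)$ about the identity, and $g$ is called a dead end if its depth is greater than $1$. -/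

import Mathlib

/-- The length of `g` in the word metric with respect to `S`: the least length of a word in the
elements of `S` and their inverses that represents `g`. It is meaningful when `S` generates `G`. -/
noncomputable def wordLength {G : Type*} [Group G] (S : Set G) (g : G) : ℕ :=
  sInf {n : ℕ | ∃ l : List G, (∀ x ∈ l, x ∈ S ∨ x⁻¹ ∈ S) ∧ l.prod = g ∧ l.length = n}

/-- The (left-invariant) word metric on `G` with respect to `S`. -/
noncomputable def wordDist {G : Type*} [Group G] (S : Set G) (g h : G) : ℕ :=
  wordLength S (g⁻¹ * h)

/-- The dead-end depth of `g`: the distance from `g` to the complement of the closed ball about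
the identity of radius `wordDist S 1 g`. This complement is nonempty when `G` is infinite and `S`
is a finite generating set; if it were empty, the value would be `0`. -/
noncomputable def deadEndDepth {G : Type*} [Group G] (S : Set G) (g : G) : ℕ :=
  sInf {n : ℕ | ∃ h : G, wordDist S 1 g < wordDist S 1 h ∧ wordDist S g h = n}

/-- A dead end is an element of depth greater than `1`. -/
def IsDeadEnd {G : Type*} [Group G] (S : Set G) (g : G) : Prop :=
  1 < deadEndDepth S g

/-- The integer matrix of an automorphism of `ℤ²` in the standard basis. -/
def autMatrix (R : AddAut (Fin 2 → ℤ)) : Matrix (Fin 2) (Fin 2) ℤ :=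
  LinearMap.toMatrix' (AddEquiv.toAddMonoidHom R).toIntLinearMap

/-- An automorphism of `ℤ²` is hyperbolic if it has no complex eigenvalue of modulus `1`. -/
def IsHyperbolicAut (R : AddAut (Fin 2 → ℤ)) : Prop :=
  ∀ μ : ℂ, Module.End.HasEigenvalue
    (Matrix.toLin' ((autMatrix R).map (Int.cast : ℤ → ℂ))) μ → ‖μ‖ ≠ 1

/-- The action of `ℤ` on `ℤ²` (both written multiplicatively) in which `n` acts by `R ^ n`. -/
def solAction (R : AddAut (Fin 2 → ℤ)) :
    Multiplicative ℤ →* MulAut (Multiplicative (Fin 2 → ℤ)) :=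
  zpowersHom (MulAut (Multiplicative (Fin 2 → ℤ))) (AddEquiv.toMultiplicative R)

/-- The group `ℤ² ⋊_R ℤ`. -/
abbrev SolGroup (R : AddAut (Fin 2 → ℤ)) : Type :=
  Multiplicative (Fin 2 → ℤ) ⋊[solAction R] Multiplicative ℤ

/-- The first standard generator of `ℤ²`, in `ℤ² ⋊_R ℤ`. -/
def solA (R : AddAut (Fin 2 → ℤ)) : SolGroup R :=
  SemidirectProduct.inl (Multiplicative.ofAdd ![1, 0])

/-- The second standard generator of `ℤ²`, in `ℤ² ⋊_R ℤ`. -/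
def solB (R : AddAut (Fin 2 → ℤ)) : SolGroup R :=
  SemidirectProduct.inl (Multiplicative.ofAdd ![0, 1])

/-- The standard generator of `ℤ`, in `ℤ² ⋊_R ℤ`. -/
def solC (R : AddAut (Fin 2 → ℤ)) : SolGroup R :=
  SemidirectProduct.inr (Multiplicative.ofAdd 1)

/-! Two facts compete on `ℤ²`. By `exists_wordLength_solInl_le`, word length is sublinear there. By
`norm_le_of_not_visitsHeight`, a word avoiding a height `j > 0` has a value under an expanding
eigenfunctional that is at most linear in its length. So if `v₀` lies in the kernel of neither the
expanding nor the contracting eigenfunctional, geodesics to all points near a large multiple of `v₀`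
visit every height between `-n` and `n`. Because `ℤ²` is commutative, such a geodesic can be
reordered to end at any height it visits, at no extra cost (`exists_word_mul`). Hence multiplying
these points by `c ^ j`, `|j| ≤ n`, does not lengthen them.

If every element could be lengthened by some word of length at most `n`, do so repeatedly from such
a point, each time dropping the height change for free. After `N` steps the length has grown by at
least `N`, while the displacement in `ℤ²` is `O(N)` and, by sublinearity, has length below `N` once
`N` is large: a contradiction. -/

section WordLength

/-! ### Word length and dead-end depth in a general group. -/

variable {G : Type*} [Group G] {S : Set G}

theorem wordLength_prod_le {l : List G} (hl : ∀ x ∈ l, x ∈ S ∨ x⁻¹ ∈ S) :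
    wordLength S l.prod ≤ l.length :=
  Nat.sInf_le ⟨l, hl, rfl, rfl⟩

theorem exists_word_of_closure_eq_top (hS : Subgroup.closure S = ⊤) (g : G) :
    ∃ l : List G, (∀ x ∈ l, x ∈ S ∨ x⁻¹ ∈ S) ∧ l.prod = g ∧ l.length = wordLength S g := by
  have hg : g ∈ Subgroup.closure S := hS ▸ Subgroup.mem_top g
  rw [← Subgroup.mem_toSubmonoid, Subgroup.closure_toSubmonoid] at hg
  obtain ⟨l, hl, hlg⟩ := Submonoid.exists_list_of_mem_closure hg
  exact Nat.sInf_mem (s := {n : ℕ | ∃ l : List G, (∀ x ∈ l, x ∈ S ∨ x⁻¹ ∈ S) ∧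
    l.prod = g ∧ l.length = n}) ⟨l.length, l, hl, hlg, rfl⟩

theorem wordLength_mul_le (hS : Subgroup.closure S = ⊤) (g h : G) :
    wordLength S (g * h) ≤ wordLength S g + wordLength S h := by
  obtain ⟨l, hl, rfl, hlen⟩ := exists_word_of_closure_eq_top hS g
  obtain ⟨m, hm, rfl, hmlen⟩ := exists_word_of_closure_eq_top hS h
  rw [← hlen, ← hmlen, ← List.prod_append, ← List.length_append]
  refine wordLength_prod_le fun x hx => ?_
  rcases List.mem_append.1 hx with hx | hx
  exacts [hl x hx, hm x hx]

theorem wordLength_le_one {g : G} (hg : g ∈ S ∨ g⁻¹ ∈ S) : wordLength S g ≤ 1 := by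
  simpa using wordLength_prod_le (l := [g]) (by simpa using hg)

theorem wordLength_inv_le (hS : Subgroup.closure S = ⊤) (g : G) :
    wordLength S g⁻¹ ≤ wordLength S g := by
  obtain ⟨l, hl, rfl, hlen⟩ := exists_word_of_closure_eq_top hS g
  rw [List.prod_inv_reverse, ← hlen]
  refine (wordLength_prod_le fun x hx => ?_).trans (by simp)
  simp only [List.mem_reverse, List.mem_map] at hx
  obtain ⟨y, hy, rfl⟩ := hx
  simpa using (hl y hy).symm

theorem wordLength_one : wordLength S (1 : G) = 0 :=
  Nat.le_zero.1 (wordLength_prod_le (S := S) (l := []) (by simp))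

theorem wordLength_pow_le (hS : Subgroup.closure S = ⊤) (g : G) (n : ℕ) :
    wordLength S (g ^ n) ≤ n * wordLength S g := by
  induction n with
  | zero => simp [wordLength_one]
  | succ n ih =>
    rw [pow_succ, add_mul, one_mul]
    exact (wordLength_mul_le hS _ _).trans (by gcongr)

theorem wordLength_zpow_le (hS : Subgroup.closure S = ⊤) (g : G) (n : ℤ) :
    wordLength S (g ^ n) ≤ n.natAbs * wordLength S g := by
  obtain ⟨m, rfl | rfl⟩ := n.eq_nat_or_neg
  · simpa using wordLength_pow_le hS g m
  · rw [zpow_neg, zpow_natCast, Int.natAbs_neg, Int.natAbs_natCast]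
    exact (wordLength_inv_le hS _).trans (wordLength_pow_le hS g m)

theorem finite_setOf_wordLength_le (hS : Subgroup.closure S = ⊤) (hfin : S.Finite) (n : ℕ) :
    {g : G | wordLength S g ≤ n}.Finite := by
  have hX : {x : G | x ∈ S ∨ x⁻¹ ∈ S}.Finite :=
    hfin.union (hfin.preimage inv_injective.injOn)
  have key (k : ℕ) : {g : G | ∃ l : List G, (∀ x ∈ l, x ∈ S ∨ x⁻¹ ∈ S) ∧
      l.prod = g ∧ l.length = k}.Finite := by
    induction k with
    | zero =>
      refine (Set.finite_singleton (1 : G)).subset ?_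
      rintro g ⟨l, -, rfl, hl⟩
      simp [List.length_eq_zero_iff.1 hl]
    | succ k ih =>
      refine (Set.Finite.image2 (· * ·) hX ih).subset ?_
      rintro g ⟨l, hl, rfl, hlen⟩
      obtain ⟨x, l, rfl⟩ := List.exists_cons_of_length_eq_add_one hlen
      exact ⟨x, hl x (by simp), l.prod, ⟨l, fun y hy => hl y (by simp [hy]), rfl,
        by simpa using hlen⟩, by simp⟩
  refine ((Set.finite_Iic n).biUnion fun k _ => key k).subset fun g hg => ?_
  exact Set.mem_biUnion (x := wordLength S g) hg (exists_word_of_closure_eq_top hS g)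

theorem wordDist_one_left (g : G) : wordDist S 1 g = wordLength S g := by
  simp [wordDist]

/-- A longer element must exist, since otherwise the infimum is over the empty set and the depth is
`0`. -/
theorem le_deadEndDepth {g : G} {n : ℕ} (hne : ∃ h, wordLength S g < wordLength S h)
    (h : ∀ w, wordLength S g < wordLength S (g * w) → n ≤ wordLength S w) :
    n ≤ deadEndDepth S g := by
  obtain ⟨h₀, hh₀⟩ := hne
  refine le_csInf ⟨_, h₀, by simpa only [wordDist_one_left] using hh₀, rfl⟩ ?_
  rintro m ⟨x, hx, rfl⟩
  rw [wordDist_one_left, wordDist_one_left] at hx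
  exact h _ (by simpa using hx)

end WordLength

/-! ### Rearranging words by height. -/

/-- `p` is an additive height on `G` with commutative kernel, for which `c` and `c⁻¹` are the only
letters over `S` that change the height, by `1` and `-1`. -/
structure IsHeight {G : Type*} [Group G] (S : Set G) (c : G) (p : G → ℤ) : Prop where
  map_mul : ∀ x y, p (x * y) = p x + p y
  letter : ∀ x, x ∈ S ∨ x⁻¹ ∈ S → p x = 0 ∨ x = c ∧ p x = 1 ∨ x = c⁻¹ ∧ p x = -1
  comm : ∀ x y, p x = 0 → p y = 0 → x * y = y * x

/-- Some prefix of the word `l` has height `j`. -/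
def VisitsHeight {G : Type*} [Group G] (p : G → ℤ) (l : List G) (j : ℤ) : Prop :=
  ∃ l₁ l₂, l = l₁ ++ l₂ ∧ p l₁.prod = j

namespace IsHeight

variable {G : Type*} [Group G] {S : Set G} {c : G} {p : G → ℤ}

theorem map_one (hp : IsHeight S c p) : p 1 = 0 := by
  simpa using hp.map_mul 1 1

theorem map_inv (hp : IsHeight S c p) (x : G) : p x⁻¹ = -p x := by
  have := hp.map_mul x x⁻¹
  rw [mul_inv_cancel, hp.map_one] at this
  omega

/-- This symmetry lets the upward results below serve for downward motion too. -/
theorem neg (hp : IsHeight S c p) : IsHeight S c⁻¹ (fun x => -p x) where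
  map_mul x y := by rw [hp.map_mul]; ring
  letter x hx := by
    rcases hp.letter x hx with h | ⟨h, h'⟩ | ⟨h, h'⟩
    · simp [h]
    · simp [h', ← h]
    · subst h
      simp [h']
  comm x y hx hy := hp.comm x y (by simpa using hx) (by simpa using hy)

theorem abs_letter_le (hp : IsHeight S c p) {x : G} (hx : x ∈ S ∨ x⁻¹ ∈ S) : |p x| ≤ 1 := by
  rcases hp.letter x hx with h | ⟨-, h⟩ | ⟨-, h⟩ <;> simp [h]

theorem abs_prod_le (hp : IsHeight S c p) {l : List G} (hl : ∀ x ∈ l, x ∈ S ∨ x⁻¹ ∈ S) :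
    |p l.prod| ≤ l.length := by
  induction l with
  | nil => simp [hp.map_one]
  | cons x l ih =>
    rw [List.prod_cons, hp.map_mul, List.length_cons]
    have h₁ := ih fun y hy => hl y (by simp [hy])
    have h₂ := hp.abs_letter_le (hl x (by simp))
    have h₃ := abs_add_le (p x) (p l.prod)
    push_cast
    omega

theorem abs_le_wordLength (hp : IsHeight S c p) (hS : Subgroup.closure S = ⊤) (g : G) :
    |p g| ≤ wordLength S g := by
  obtain ⟨l, hl, rfl, hlen⟩ := exists_word_of_closure_eq_top hS g
  exact hlen ▸ hp.abs_prod_le hl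

/-- A word ending at height at least `j ≥ 0` visits `j`. -/
theorem visitsHeight (hp : IsHeight S c p) {l : List G} (hl : ∀ x ∈ l, x ∈ S ∨ x⁻¹ ∈ S) {j : ℤ}
    (hj : 0 ≤ j) (h : j ≤ p l.prod) : VisitsHeight p l j := by
  induction l using List.reverseRecOn with
  | nil => exact ⟨[], [], rfl, by simp [hp.map_one] at h ⊢; omega⟩
  | append_singleton l x ih =>
    rcases h.eq_or_lt with h | h
    · exact ⟨l ++ [x], [], by simp, h.symm⟩
    · rw [List.prod_append, hp.map_mul, List.prod_singleton] at h
      have := (abs_le.1 (hp.abs_letter_le (hl x (by simp)))).2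
      obtain ⟨l₁, l₂, rfl, h'⟩ := ih (fun y hy => hl y (by simp [hy])) (by omega)
      exact ⟨l₁, l₂ ++ [x], by simp, h'⟩

/-- A descending word contains a downward letter after which it makes a loop. -/
theorem exists_eq_append_inv_cons (hp : IsHeight S c p) {l : List G}
    (hl : ∀ x ∈ l, x ∈ S ∨ x⁻¹ ∈ S) (h : p l.prod < 0) :
    ∃ l₁ l₂, l = l₁ ++ c⁻¹ :: l₂ ∧ p l₂.prod = 0 := by
  induction l with
  | nil => simp [hp.map_one] at h
  | cons x l ih =>
    rcases lt_or_ge (p l.prod) 0 with h' | h'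
    · obtain ⟨l₁, l₂, rfl, h₂⟩ := ih (fun y hy => hl y (by simp [hy])) h'
      exact ⟨x :: l₁, l₂, by simp, h₂⟩
    · rw [List.prod_cons, hp.map_mul] at h
      rcases hp.letter x (hl x (by simp)) with h₁ | ⟨-, h₁⟩ | ⟨rfl, h₁⟩
      · omega
      · omega
      · exact ⟨[], l, rfl, by omega⟩

/-- A word that ends at height `i ≥ 0` and visits a larger height `j` can be rearranged into a
word that ends one level higher and is no longer. -/
theorem exists_word_mul (hp : IsHeight S c p) {l : List G} (hl : ∀ x ∈ l, x ∈ S ∨ x⁻¹ ∈ S) {j : ℤ}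
    (h0 : 0 ≤ p l.prod) (hlt : p l.prod < j) (hv : VisitsHeight p l j) :
    ∃ l' : List G, (∀ x ∈ l', x ∈ S ∨ x⁻¹ ∈ S) ∧ l'.prod = l.prod * c ∧
      l'.length ≤ l.length ∧ VisitsHeight p l' j := by
  obtain ⟨s, q, rfl, hs⟩ := hv
  have hq : p q.prod < 0 := by
    rw [List.prod_append, hp.map_mul] at hlt
    omega
  obtain ⟨q₁, q₂, rfl, hq₂⟩ :=
    hp.exists_eq_append_inv_cons (fun x hx => hl x (by simp [hx])) hq
  obtain ⟨r₁, r₂, rfl, hr⟩ := hp.visitsHeight (l := s) (fun x hx => hl x (by simp [hx])) h0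
    (by omega)
  simp only [List.prod_append, List.prod_cons, hp.map_mul] at hr hs
  have hm : p (r₂.prod * q₁.prod * c⁻¹) = 0 := by
    simp only [hp.map_mul]
    omega
  -- The word is `r₁ r₂ q₁ c⁻¹ q₂`, where `r₂ q₁ c⁻¹` and `q₂` are commuting loops. Moving `q₂`
  -- forward brings `c⁻¹` to the end, where the new `c` cancels it; `r₁ q₂ r₂` still has height `j`.
  refine ⟨r₁ ++ q₂ ++ r₂ ++ q₁, fun x hx => hl x ?_, ?_, ?_, r₁ ++ q₂ ++ r₂, q₁, rfl, ?_⟩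
  · simp only [List.mem_append, List.mem_cons] at hx ⊢
    tauto
  · have := hp.comm _ _ hm hq₂
    simp only [List.prod_append, List.prod_cons]
    calc r₁.prod * q₂.prod * r₂.prod * q₁.prod
        = r₁.prod * (q₂.prod * (r₂.prod * q₁.prod * c⁻¹)) * c := by group
      _ = _ := by rw [← this]; group
  · simp only [List.length_append, List.length_cons]
    omega
  · simp only [List.prod_append, hp.map_mul]
    omega

/-- The endpoint is raised one level at a time; each rearrangement preserves the visit to `j`, which
allows the next. -/
theorem wordLength_mul_pow_le (hp : IsHeight S c p) {l : List G}
    (hl : ∀ x ∈ l, x ∈ S ∨ x⁻¹ ∈ S) (h0 : p l.prod = 0) (hc : p c = 1) {j : ℕ}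
    (hv : VisitsHeight p l j) : wordLength S (l.prod * c ^ j) ≤ l.length := by
  have key (i : ℕ) (hi : i ≤ j) : ∃ l' : List G, (∀ x ∈ l', x ∈ S ∨ x⁻¹ ∈ S) ∧
      l'.prod = l.prod * c ^ i ∧ p l'.prod = i ∧ l'.length ≤ l.length ∧ VisitsHeight p l' j := by
    induction i with
    | zero => exact ⟨l, hl, by simp, by simpa using h0, le_rfl, hv⟩
    | succ i ih =>
      obtain ⟨m, hm, hmp, hmi, hml, hmv⟩ := ih (by omega)
      obtain ⟨m', hm', hmp', hml', hmv'⟩ :=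
        hp.exists_word_mul hm (j := j) (by omega) (by omega) hmv
      refine ⟨m', hm', by rw [hmp', hmp, pow_succ, mul_assoc], ?_, by omega, hmv'⟩
      rw [hmp', hp.map_mul, hmi, hc]
      push_cast
      rfl
  obtain ⟨l', hl', hlp, -, hlen, -⟩ := key j le_rfl
  exact hlp ▸ (wordLength_prod_le hl').trans hlen

/-- A function twisted by powers of `μ` along the height grows at most linearly, at rate governed
by `‖μ‖ ^ j`, along words that do not visit `j`. -/
theorem norm_le_of_not_visitsHeight (hp : IsHeight S c p) {Φ : G → ℂ} {μ : ℂ} {K : ℝ}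
    (hμ : 1 ≤ ‖μ‖) (hΦ : ∀ x y, Φ (x * y) = Φ x + μ ^ p x * Φ y)
    (hK : ∀ x, x ∈ S ∨ x⁻¹ ∈ S → ‖Φ x‖ ≤ K) {l : List G} (hl : ∀ x ∈ l, x ∈ S ∨ x⁻¹ ∈ S) {j : ℕ}
    (hj : 0 < j) (hv : ¬ VisitsHeight p l j) :
    p l.prod < j ∧ ‖Φ l.prod‖ ≤ l.length * (‖μ‖ ^ j * K) := by
  induction l using List.reverseRecOn with
  | nil =>
    have : Φ 1 = 0 := by simpa [hp.map_one] using hΦ 1 1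
    simp [hp.map_one, this, hj]
  | append_singleton l x ih =>
    have hx := hl x (by simp)
    obtain ⟨h₁, h₂⟩ := ih (fun y hy => hl y (by simp [hy])) (by
      rintro ⟨l₁, l₂, rfl, h⟩
      exact hv ⟨l₁, l₂ ++ [x], by simp, h⟩)
    have h₃ : p (l ++ [x]).prod ≠ j := fun h => hv ⟨_, [], by simp, h⟩
    have h₄ := (abs_le.1 (hp.abs_letter_le hx)).2
    rw [List.prod_append, List.prod_singleton, hp.map_mul] at h₃
    rw [List.prod_append, List.prod_singleton, hp.map_mul, hΦ]
    refine ⟨by omega, (norm_add_le _ _).trans ?_⟩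
    rw [norm_mul, norm_zpow, List.length_append, Nat.cast_add, add_mul]
    have h₅ : ‖μ‖ ^ p l.prod ≤ ‖μ‖ ^ j := by
      rw [← zpow_natCast]
      exact zpow_le_zpow_right₀ hμ h₁.le
    have := mul_le_mul h₅ (hK x hx) (norm_nonneg _) (by positivity)
    simp only [List.length_singleton, Nat.cast_one, one_mul]
    linarith

theorem wordLength_mul_pow_le_of_lt_norm (hp : IsHeight S c p) (hS : Subgroup.closure S = ⊤)
    {Φ : G → ℂ} {μ : ℂ} {K : ℝ} (hμ : 1 ≤ ‖μ‖) (hΦ : ∀ x y, Φ (x * y) = Φ x + μ ^ p x * Φ y)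
    (hK : ∀ x, x ∈ S ∨ x⁻¹ ∈ S → ‖Φ x‖ ≤ K) (hc : p c = 1) {g : G} (hg : p g = 0) {j n : ℕ}
    (hjn : j ≤ n) (h : wordLength S g * (‖μ‖ ^ n * K) < ‖Φ g‖) :
    wordLength S (g * c ^ j) ≤ wordLength S g := by
  rcases Nat.eq_zero_or_pos j with rfl | hj
  · simp
  obtain ⟨l, hl, rfl, hlen⟩ := exists_word_of_closure_eq_top hS g
  rw [← hlen] at h ⊢
  refine hp.wordLength_mul_pow_le hl hg hc ?_
  by_contra hv
  refine h.not_ge ((hp.norm_le_of_not_visitsHeight hμ hΦ hK hl hj hv).2.trans ?_)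
  -- `0 ≤ K` is not assumed: it comes from a letter of the word, and the empty word needs no sign.
  rcases l with _ | ⟨x, l⟩
  · simp
  have : 0 ≤ K := (norm_nonneg _).trans (hK x (hl x (by simp)))
  gcongr

end IsHeight

/-! ### Eigenvalues and trace of a hyperbolic automorphism. -/

theorem autMatrix_mulVec (R : AddAut (Fin 2 → ℤ)) (v : Fin 2 → ℤ) :
    (autMatrix R).mulVec v = R v := by
  rw [autMatrix, LinearMap.toMatrix'_mulVec]
  rfl

theorem autMatrix_det (R : AddAut (Fin 2 → ℤ)) :
    (autMatrix R).det = 1 ∨ (autMatrix R).det = -1 := by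
  have h : autMatrix R * autMatrix R.symm = 1 := by
    refine Matrix.toLin'.injective (LinearMap.ext fun v => ?_)
    simp only [Matrix.toLin'_apply, Matrix.one_mulVec, ← Matrix.mulVec_mulVec, autMatrix_mulVec, AddEquiv.apply_symm_apply]
  exact Int.isUnit_iff.1 (IsUnit.of_mul_eq_one (autMatrix R.symm).det (by rw [← Matrix.det_mul, h, Matrix.det_one]))

theorem Matrix.det_intCast_sub_scalar_fin_two (M : Matrix (Fin 2) (Fin 2) ℤ) (z : ℂ) :
    (M.map (Int.cast : ℤ → ℂ) - z • 1).det = z ^ 2 - M.trace * z + M.det := by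
  simp [Matrix.det_fin_two, Matrix.trace_fin_two]
  ring

theorem IsHyperbolicAut.norm_ne_one {R : AddAut (Fin 2 → ℤ)} (hR : IsHyperbolicAut R) {z : ℂ}
    (hz : z ^ 2 - (autMatrix R).trace * z + (autMatrix R).det = 0) : ‖z‖ ≠ 1 := by
  rw [← Matrix.det_intCast_sub_scalar_fin_two] at hz
  obtain ⟨w, hw, h⟩ := Matrix.exists_mulVec_eq_zero_iff.2 hz
  refine hR z (Module.End.hasEigenvalue_of_hasEigenvector (x := w) ⟨?_, hw⟩)
  rw [Module.End.mem_eigenspace_iff, Matrix.toLin'_apply]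
  rwa [Matrix.sub_mulVec, Matrix.smul_mulVec, Matrix.one_mulVec, sub_eq_zero] at h

/-- A root of the characteristic polynomial has a nonzero eigenfunctional. -/
theorem exists_eigenfunctional (R : AddAut (Fin 2 → ℤ)) {z : ℂ}
    (hz : z ^ 2 - (autMatrix R).trace * z + (autMatrix R).det = 0) :
    ∃ φ : (Fin 2 → ℤ) →+ ℂ, φ ≠ 0 ∧ ∀ v, φ (R v) = z * φ v := by
  rw [← Matrix.det_intCast_sub_scalar_fin_two] at hz
  obtain ⟨w, hw, h⟩ := Matrix.exists_vecMul_eq_zero_iff.2 hz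
  rw [Matrix.vecMul_sub, Matrix.vecMul_smul, Matrix.vecMul_one, sub_eq_zero] at h
  refine ⟨⟨⟨fun v => w 0 * v 0 + w 1 * v 1, by simp⟩, fun u v => ?_⟩, fun h0 => hw ?_, fun v => ?_⟩
  · simp; ring
  · have h1 := DFunLike.congr_fun h0 ![1, 0]
    have h2 := DFunLike.congr_fun h0 ![0, 1]
    ext i
    fin_cases i
    · simpa using h1
    · simpa using h2
  · have h1 := congr_fun h 0
    have h2 := congr_fun h 1
    simp [Matrix.vecMul, dotProduct, Fin.sum_univ_two] at h1 h2
    simp [← autMatrix_mulVec]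
    linear_combination (v 0 : ℂ) * h1 + (v 1 : ℂ) * h2

/-- The two roots have product `±1` and neither has modulus `1`, so they lie on opposite sides of
the unit circle. -/
theorem IsHyperbolicAut.exists_roots {R : AddAut (Fin 2 → ℤ)} (hR : IsHyperbolicAut R) :
    ∃ z w : ℂ, 1 < ‖z‖ ∧ ‖w‖ < 1 ∧ w ≠ 0 ∧
      z ^ 2 - (autMatrix R).trace * z + (autMatrix R).det = 0 ∧
      w ^ 2 - (autMatrix R).trace * w + (autMatrix R).det = 0 := by
  obtain ⟨s, hs⟩ := IsAlgClosed.exists_pow_nat_eq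
    (((autMatrix R).trace : ℂ) ^ 2 - 4 * (autMatrix R).det) two_pos
  set t : ℂ := ((autMatrix R).trace : ℂ) with ht
  have hd : ‖((autMatrix R).det : ℂ)‖ = 1 := by
    rcases autMatrix_det R with h | h <;> simp [h]
  set d : ℂ := ((autMatrix R).det : ℂ)
  have h₁ : ((t + s) / 2) ^ 2 - t * ((t + s) / 2) + d = 0 := by linear_combination hs / 4
  have h₂ : ((t - s) / 2) ^ 2 - t * ((t - s) / 2) + d = 0 := by linear_combination hs / 4
  have h₁₂ : ‖(t + s) / 2‖ * ‖(t - s) / 2‖ = 1 := by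
    rw [← norm_mul, ← hd]
    congr 1
    linear_combination -hs / 4
  have key (z w : ℂ) (hz : 1 < ‖z‖) (hzw : ‖z‖ * ‖w‖ = 1) : ‖w‖ < 1 ∧ w ≠ 0 := by
    refine ⟨by nlinarith [norm_nonneg w], ?_⟩
    rintro rfl
    simp at hzw
  rcases (hR.norm_ne_one h₁).lt_or_gt with h | h
  · have h' : 1 < ‖(t - s) / 2‖ := by
      refine lt_of_le_of_ne ?_ (hR.norm_ne_one h₂).symm
      nlinarith [norm_nonneg ((t - s) / 2)]
    obtain ⟨h₃, h₄⟩ := key _ _ h' (by rwa [mul_comm])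
    exact ⟨_, _, h', h₃, h₄, h₂, h₁⟩
  · obtain ⟨h₃, h₄⟩ := key _ _ h h₁₂
    exact ⟨_, _, h, h₃, h₄, h₁, h₂⟩

/-- The trace of the square of a hyperbolic automorphism is at least `3`. -/
theorem IsHyperbolicAut.three_le {R : AddAut (Fin 2 → ℤ)} (hR : IsHyperbolicAut R) :
    3 ≤ (autMatrix R).trace ^ 2 - 2 * (autMatrix R).det := by
  by_contra! hlt
  rcases autMatrix_det R with h | h
  · have hsq : (((autMatrix R).trace : ℝ)) ^ 2 ≤ 4 := by
      have : (autMatrix R).trace ^ 2 ≤ 4 := by omega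
      exact_mod_cast this
    have hr := Real.sq_sqrt (sub_nonneg.2 hsq)
    set t : ℝ := ((autMatrix R).trace : ℝ) with ht
    set r := Real.sqrt (4 - t ^ 2)
    -- For determinant `1` and `t ^ 2 ≤ 4`, this root has squared modulus `(t ^ 2 + (4 - t ^ 2)) / 4
    -- = 1`.
    refine hR.norm_ne_one (z := ⟨t / 2, r / 2⟩) ?_ ?_
    · rw [h, show (((autMatrix R).trace : ℤ) : ℂ) = (t : ℂ) by simp [ht]]
      apply Complex.ext
      · simp [pow_two]
        linarith
      · simp [pow_two]
        ring
    · rw [Complex.norm_def, Complex.normSq_mk, Real.sqrt_eq_one]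
      linarith
  · have h0 : (autMatrix R).trace = 0 := by
      have : (autMatrix R).trace ^ 2 ≤ 0 := by omega
      nlinarith
    refine hR.norm_ne_one (z := 1) ?_ (by simp)
    simp [h, h0]

/-- Cayley–Hamilton for `R ^ 2`, which has determinant `1` whatever the sign of `det R`. -/
theorem autMatrix_trace_sq_smul (R : AddAut (Fin 2 → ℤ)) (v : Fin 2 → ℤ) :
    ((autMatrix R).trace ^ 2 - 2 * (autMatrix R).det) • R (R v) = R (R (R (R v))) + v := by
  have hd : (autMatrix R).det ^ 2 = 1 := by rcases autMatrix_det R with h | h <;> simp [h]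
  have hch (u : Fin 2 → ℤ) : R (R u) = (autMatrix R).trace • R u - (autMatrix R).det • u := by
    simp only [← autMatrix_mulVec, Matrix.trace_fin_two, Matrix.det_fin_two]
    ext i
    fin_cases i <;> simp [Matrix.mulVec, dotProduct, Fin.sum_univ_two] <;> ring
  have h₁ := hch v
  have h₂ := hch (R v)
  have h₃ := hch (R (R v))
  ext i
  replace h₁ := congr_fun h₁ i
  replace h₂ := congr_fun h₂ i
  replace h₃ := congr_fun h₃ i
  simp only [Pi.add_apply, Pi.sub_apply, Pi.smul_apply, smul_eq_mul] at *
  linear_combination -(autMatrix R).det * h₁ - (autMatrix R).trace * h₂ - h₃ + v i * hd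

/-- A group is not the union of two proper subgroups, here the kernels. -/
theorem exists_ne_zero_of_ne_zero {φ ψ : (Fin 2 → ℤ) →+ ℂ} (hφ : φ ≠ 0) (hψ : ψ ≠ 0) :
    ∃ v, φ v ≠ 0 ∧ ψ v ≠ 0 := by
  obtain ⟨x, hx⟩ := DFunLike.ne_iff.1 hφ
  obtain ⟨y, hy⟩ := DFunLike.ne_iff.1 hψ
  by_cases hx' : ψ x = 0
  · by_cases hy' : φ y = 0
    · exact ⟨x + y, by simpa [hy'] using hx, by simpa [hx'] using hy⟩
    · exact ⟨y, hy', hy⟩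
  · exact ⟨x, hx, hx'⟩

/-! ### The group `ℤ² ⋊_R ℤ` and its generators. -/

open Filter

/-- The inclusion of `ℤ²` in `ℤ² ⋊_R ℤ`. -/
def solInl (R : AddAut (Fin 2 → ℤ)) (v : Fin 2 → ℤ) : SolGroup R :=
  SemidirectProduct.inl (Multiplicative.ofAdd v)

/-- The projection of `ℤ² ⋊_R ℤ` to `ℤ`. -/
def solHeight (R : AddAut (Fin 2 → ℤ)) (g : SolGroup R) : ℤ :=
  g.right.toAdd

/-- The standard generating set of `ℤ² ⋊_R ℤ`. -/
abbrev solGens (R : AddAut (Fin 2 → ℤ)) : Set (SolGroup R) :=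
  {solA R, solB R, solC R}

section Sol

variable (R : AddAut (Fin 2 → ℤ))

theorem solInl_add (u v : Fin 2 → ℤ) : solInl R (u + v) = solInl R u * solInl R v :=
  map_mul SemidirectProduct.inl (Multiplicative.ofAdd u) (Multiplicative.ofAdd v)

theorem solInl_zsmul (n : ℤ) (v : Fin 2 → ℤ) : solInl R (n • v) = solInl R v ^ n :=
  map_zpow SemidirectProduct.inl (Multiplicative.ofAdd v) n

theorem solC_zpow (n : ℤ) : solC R ^ n = SemidirectProduct.inr (Multiplicative.ofAdd n) := by
  rw [solC, ← map_zpow, ← ofAdd_zsmul, smul_eq_mul, mul_one]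

theorem solInl_eq_zpow_mul_zpow (v : Fin 2 → ℤ) :
    solInl R v = solA R ^ v 0 * solB R ^ v 1 := by
  change _ = solInl R ![1, 0] ^ v 0 * solInl R ![0, 1] ^ v 1
  rw [← solInl_zsmul, ← solInl_zsmul, ← solInl_add]
  congr 1
  ext i
  fin_cases i <;> simp

theorem eq_solInl_mul_zpow (g : SolGroup R) :
    g = solInl R g.left.toAdd * solC R ^ solHeight R g := by
  rw [solC_zpow]
  exact (SemidirectProduct.inl_left_mul_inr_right g).symm

theorem closure_solGens : Subgroup.closure (solGens R) = ⊤ := by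
  refine eq_top_iff.2 fun g _ => ?_
  rw [eq_solInl_mul_zpow R g, solInl_eq_zpow_mul_zpow]
  refine mul_mem (mul_mem ?_ ?_) ?_ <;>
    exact zpow_mem (Subgroup.subset_closure (by simp)) _

theorem solInl_map (v : Fin 2 → ℤ) : solInl R (R v) = solC R * solInl R v * (solC R)⁻¹ := by
  have := SemidirectProduct.inl_aut (φ := solAction R) (Multiplicative.ofAdd 1)
    (Multiplicative.ofAdd v)
  rw [map_inv] at this
  have h : solAction R (Multiplicative.ofAdd 1) (Multiplicative.ofAdd v) =
      Multiplicative.ofAdd (R v) := by simp [solAction]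
  exact (congrArg SemidirectProduct.inl h).symm.trans this

/-! ### Distortion of `ℤ²`. -/

theorem wordLength_solC_le : wordLength (solGens R) (solC R) ≤ 1 :=
  wordLength_le_one (Or.inl (by simp))

theorem wordLength_solInl_add_le (u v : Fin 2 → ℤ) : wordLength (solGens R) (solInl R (u + v)) ≤
    wordLength (solGens R) (solInl R u) + wordLength (solGens R) (solInl R v) :=
  solInl_add R u v ▸ wordLength_mul_le (closure_solGens R) _ _

theorem wordLength_conj_solC_le (g : SolGroup R) :
    wordLength (solGens R) (solC R * g * (solC R)⁻¹) ≤ wordLength (solGens R) g + 2 ∧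
    wordLength (solGens R) ((solC R)⁻¹ * g * solC R) ≤ wordLength (solGens R) g + 2 := by
  have hS := closure_solGens R
  have h₁ := wordLength_solC_le R
  have h₂ := wordLength_inv_le hS (solC R)
  constructor
  · have := wordLength_mul_le hS (solC R * g) (solC R)⁻¹
    have := wordLength_mul_le hS (solC R) g
    omega
  · have := wordLength_mul_le hS ((solC R)⁻¹ * g) (solC R)
    have := wordLength_mul_le hS (solC R)⁻¹ g
    omega

theorem wordLength_solInl_map_le (v : Fin 2 → ℤ) :
    wordLength (solGens R) (solInl R (R v)) ≤ wordLength (solGens R) (solInl R v) + 2 :=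
  solInl_map R v ▸ (wordLength_conj_solC_le R _).1

theorem wordLength_solInl_le_map (v : Fin 2 → ℤ) :
    wordLength (solGens R) (solInl R v) ≤ wordLength (solGens R) (solInl R (R v)) + 2 := by
  have h := (wordLength_conj_solC_le R (solInl R (R v))).2
  rwa [solInl_map, show (solC R)⁻¹ * (solC R * solInl R v * (solC R)⁻¹) * solC R = solInl R v by
    group, ← solInl_map] at h

/-- With `v = R (R u)`, the multiple is `R ^ 4 u + u`, and each summand is two conjugations by `c`
or `c⁻¹` away from `v`, costing `4`. -/
theorem wordLength_solInl_trace_smul_le (v : Fin 2 → ℤ) :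
    wordLength (solGens R)
      (solInl R (((autMatrix R).trace ^ 2 - 2 * (autMatrix R).det) • v)) ≤
      2 * wordLength (solGens R) (solInl R v) + 8 := by
  obtain ⟨u, rfl⟩ : ∃ u, R (R u) = v := ⟨R.symm (R.symm v), by simp⟩
  rw [autMatrix_trace_sq_smul]
  have h₁ := wordLength_solInl_add_le R (R (R (R (R u)))) u
  have h₂ := wordLength_solInl_map_le R (R (R (R u)))
  have h₃ := wordLength_solInl_map_le R (R (R u))
  have h₄ := wordLength_solInl_le_map R (R u)
  have h₅ := wordLength_solInl_le_map R u
  omega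

/-- Adding `8` turns the recursion `x ↦ 2 * x + 8` into doubling. -/
theorem wordLength_solInl_trace_pow_smul_le (k : ℕ) (v : Fin 2 → ℤ) :
    wordLength (solGens R)
      (solInl R (((autMatrix R).trace ^ 2 - 2 * (autMatrix R).det) ^ k • v)) + 8 ≤
      2 ^ k * (wordLength (solGens R) (solInl R v) + 8) := by
  have hT := wordLength_solInl_trace_smul_le R
  set T : ℤ := (autMatrix R).trace ^ 2 - 2 * (autMatrix R).det
  induction k with
  | zero => simp
  | succ k ih =>
    rw [pow_succ', mul_smul, pow_succ', mul_assoc]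
    have := hT (T ^ k • v)
    omega

theorem wordLength_solInl_le_norm (v : Fin 2 → ℤ) :
    (wordLength (solGens R) (solInl R v) : ℝ) ≤ 2 * ‖v‖ := by
  have hS := closure_solGens R
  have h₀ := wordLength_mul_le hS (solA R ^ v 0) (solB R ^ v 1)
  have h₁ := wordLength_zpow_le hS (solA R) (v 0)
  have h₂ := wordLength_zpow_le hS (solB R) (v 1)
  have h₃ : wordLength (solGens R) (solA R) ≤ 1 := wordLength_le_one (Or.inl (by simp))
  have h₄ : wordLength (solGens R) (solB R) ≤ 1 := wordLength_le_one (Or.inl (by simp))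
  have h₅ : wordLength (solGens R) (solInl R v) ≤ (v 0).natAbs + (v 1).natAbs := by
    rw [solInl_eq_zpow_mul_zpow]
    exact h₀.trans (add_le_add (h₁.trans (by simpa using Nat.mul_le_mul_left _ h₃))
      (h₂.trans (by simpa using Nat.mul_le_mul_left _ h₄)))
  have h₆ (i : Fin 2) : ((v i).natAbs : ℝ) ≤ ‖v‖ := by
    rw [Nat.cast_natAbs, Int.cast_abs, ← Int.norm_eq_abs]
    exact norm_le_pi_norm v i
  have h₇ : (wordLength (solGens R) (solInl R v) : ℝ) ≤ (v 0).natAbs + (v 1).natAbs := by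
    exact_mod_cast h₅
  linarith [h₆ 0, h₆ 1]

variable {R}

/-- `ℤ²` is distorted in `ℤ² ⋊_R ℤ`: the word length is sublinear on it. -/
theorem IsHyperbolicAut.exists_wordLength_solInl_le (hR : IsHyperbolicAut R) {ε : ℝ} (hε : 0 < ε) :
    ∃ C : ℝ, ∀ v, (wordLength (solGens R) (solInl R v) : ℝ) ≤ ε * ‖v‖ + C := by
  obtain ⟨k, hk⟩ := exists_pow_lt_of_lt_one (half_pos hε) (show (2 / 3 : ℝ) < 1 by norm_num)
  have hT := hR.three_le
  have hpow := wordLength_solInl_trace_pow_smul_le R k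
  set T : ℤ := (autMatrix R).trace ^ 2 - 2 * (autMatrix R).det
  have hT' : (3 : ℝ) ≤ T := by exact_mod_cast hT
  have hTk : 0 < T ^ k := by positivity
  have hTk' : (0 : ℝ) < (T : ℝ) ^ k := by positivity
  -- Divide `v` by `T ^ k` with remainder. The quotient costs about `2 * (2 / T) ^ k * ‖v‖`, small
  -- because `T ≥ 3`. In the constant, `8 * 2 ^ k` comes from the recursion, `2 * 2 ^ k` from
  -- rounding the quotient, and `2 * T ^ k` from the remainder.
  refine ⟨2 ^ k * 10 + 2 * T ^ k, fun v => ?_⟩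
  set q : Fin 2 → ℤ := fun i => v i / T ^ k with hq
  set r : Fin 2 → ℤ := fun i => v i % T ^ k with hr
  have hv : v = T ^ k • q + r := by
    ext i
    simp [hq, hr, Int.mul_ediv_add_emod]
  have hrn : ‖r‖ ≤ (T : ℝ) ^ k := by
    refine (pi_norm_le_iff_of_nonneg hTk'.le).2 fun i => ?_
    rw [Int.norm_eq_abs, ← Int.cast_abs, abs_of_nonneg (Int.emod_nonneg _ hTk.ne')]
    exact_mod_cast (Int.emod_lt_of_pos _ hTk).le
  have hqn : (T : ℝ) ^ k * ‖q‖ ≤ ‖v‖ + (T : ℝ) ^ k := by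
    have h : T ^ k • q = v - r := by rw [hv]; simp
    calc (T : ℝ) ^ k * ‖q‖ = ‖T ^ k • q‖ := by
          rw [norm_smul, Int.norm_eq_abs, Int.cast_pow, abs_of_pos hTk']
      _ ≤ ‖v‖ + ‖r‖ := h ▸ norm_sub_le v r
      _ ≤ _ := by gcongr
  have h₁ : (wordLength (solGens R) (solInl R (T ^ k • q)) : ℝ) + 8 ≤
      2 ^ k * (wordLength (solGens R) (solInl R q) + 8) := by exact_mod_cast hpow q
  have h₂ := wordLength_solInl_le_norm R q
  have h₃ := wordLength_solInl_le_norm R r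
  have h₄ : (wordLength (solGens R) (solInl R v) : ℝ) ≤
      wordLength (solGens R) (solInl R (T ^ k • q)) + wordLength (solGens R) (solInl R r) := by
    have := wordLength_solInl_add_le R (T ^ k • q) r
    rw [← hv] at this
    exact_mod_cast this
  have h₅ : (2 : ℝ) ^ k ≤ ε / 2 * (T : ℝ) ^ k := by
    calc (2 : ℝ) ^ k = (2 / 3) ^ k * 3 ^ k := by rw [← mul_pow]; norm_num
      _ ≤ ε / 2 * (T : ℝ) ^ k := by gcongr
  have h₆ : (2 : ℝ) ^ k * ‖q‖ ≤ ε / 2 * ‖v‖ + 2 ^ k := by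
    have h : ‖q‖ ≤ ‖v‖ / (T : ℝ) ^ k + 1 := by
      rw [← sub_nonneg] at hqn ⊢
      have : ‖v‖ / (T : ℝ) ^ k + 1 - ‖q‖ =
          (‖v‖ + (T : ℝ) ^ k - (T : ℝ) ^ k * ‖q‖) / (T : ℝ) ^ k := by field_simp
      rw [this]
      positivity
    calc (2 : ℝ) ^ k * ‖q‖ ≤ 2 ^ k * (‖v‖ / (T : ℝ) ^ k + 1) := by gcongr
      _ = 2 ^ k * (‖v‖ / (T : ℝ) ^ k) + 2 ^ k := by ring
      _ ≤ ε / 2 * (T : ℝ) ^ k * (‖v‖ / (T : ℝ) ^ k) + 2 ^ k := by gcongr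
      _ = ε / 2 * ‖v‖ + 2 ^ k := by field_simp
  have h₇ : (2 : ℝ) ^ k * wordLength (solGens R) (solInl R q) ≤ 2 ^ k * (2 * ‖q‖) := by gcongr
  linarith

/-! ### Points of `ℤ²` whose geodesics climb and descend. -/

theorem exists_norm_map_le (φ : (Fin 2 → ℤ) →+ ℂ) : ∃ B : ℝ, 0 ≤ B ∧ ∀ v, ‖φ v‖ ≤ B * ‖v‖ := by
  refine ⟨‖φ ![1, 0]‖ + ‖φ ![0, 1]‖, by positivity, fun v => ?_⟩
  have hv : v = v 0 • ![1, 0] + v 1 • ![0, 1] := by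
    ext i
    fin_cases i <;> simp
  have h (i : Fin 2) (u : Fin 2 → ℤ) : ‖φ (v i • u)‖ ≤ ‖v‖ * ‖φ u‖ := by
    rw [map_zsmul, zsmul_eq_mul, norm_mul, Complex.norm_intCast, ← Int.norm_eq_abs]
    gcongr
    exact norm_le_pi_norm v i
  calc ‖φ v‖ = ‖φ (v 0 • ![1, 0]) + φ (v 1 • ![0, 1])‖ := by rw [← map_add, ← hv]
    _ ≤ ‖v‖ * ‖φ ![1, 0]‖ + ‖v‖ * ‖φ ![0, 1]‖ := (norm_add_le _ _).trans (add_le_add (h _ _) (h _ _))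
    _ = _ := by ring

/-- The right side grows like `t * ‖φ v₀‖`; distortion, with `ε` tuned to `K`, holds the left side
to half that rate, uniformly in bounded `u`. -/
theorem IsHyperbolicAut.eventually_wordLength_mul_lt (hR : IsHyperbolicAut R)
    {φ : (Fin 2 → ℤ) →+ ℂ} {v₀ : Fin 2 → ℤ} (hφ : φ v₀ ≠ 0) {K M : ℝ} (hK : 0 < K) :
    ∀ᶠ t : ℕ in atTop, ∀ u : Fin 2 → ℤ, ‖u‖ ≤ M →
      wordLength (solGens R) (solInl R (t • v₀ + u)) * K < ‖φ (t • v₀ + u)‖ := by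
  obtain ⟨B, hB, hBφ⟩ := exists_norm_map_le φ
  have ha : 0 < ‖φ v₀‖ := norm_pos_iff.2 hφ
  have hb : 0 < ‖v₀‖ + 1 := by positivity
  obtain ⟨C, hC⟩ := hR.exists_wordLength_solInl_le
    (show 0 < ‖φ v₀‖ / (2 * K * (‖v₀‖ + 1)) by positivity)
  set ε := ‖φ v₀‖ / (2 * K * (‖v₀‖ + 1)) with hε
  have hεK : K * (ε * (‖v₀‖ + 1)) = ‖φ v₀‖ / 2 := by
    rw [hε]
    field_simp
  have hε0 : 0 ≤ ε := by positivity
  have hlim : Tendsto (fun t : ℕ => (t : ℝ) * (‖φ v₀‖ / 2)) atTop atTop :=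
    tendsto_natCast_atTop_atTop.atTop_mul_const (by positivity)
  filter_upwards [hlim.eventually_gt_atTop (K * (ε * M + C) + B * M)] with t ht u hu
  have h₁ : ‖t • v₀ + u‖ ≤ t * ‖v₀‖ + M := by
    refine (norm_add_le _ _).trans (add_le_add ?_ hu)
    exact norm_nsmul_le
  have h₂ : (t : ℝ) * ‖φ v₀‖ - B * M ≤ ‖φ (t • v₀ + u)‖ := by
    have h₃ : ‖φ u‖ ≤ B * M := (hBφ u).trans (by gcongr)
    have h₄ := norm_sub_le (φ (t • v₀ + u)) (φ u)
    have h₅ : φ (t • v₀ + u) - φ u = t * φ v₀ := by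
      rw [map_add, add_sub_cancel_right, map_nsmul, nsmul_eq_mul]
    rw [h₅, norm_mul, Complex.norm_natCast] at h₄
    linarith
  have h₅ : (wordLength (solGens R) (solInl R (t • v₀ + u)) : ℝ) * K ≤
      (ε * (t * (‖v₀‖ + 1) + M) + C) * K := by
    gcongr
    refine (hC _).trans ?_
    gcongr
    refine h₁.trans ?_
    gcongr
    linarith
  have h₆ : (ε * (t * (‖v₀‖ + 1) + M) + C) * K =
      t * (K * (ε * (‖v₀‖ + 1))) + K * (ε * M + C) := by ring
  rw [hεK] at h₆
  linarith

variable (R)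

theorem isHeight_solHeight : IsHeight (solGens R) (solC R) (solHeight R) where
  map_mul x y := rfl
  letter x hx := by
    have key (y) (hy : y ∈ solGens R) : solHeight R y = 0 ∨ y = solC R ∧ solHeight R y = 1 := by
      rcases hy with rfl | rfl | rfl
      · exact Or.inl rfl
      · exact Or.inl rfl
      · exact Or.inr ⟨rfl, rfl⟩
    have hinv : solHeight R x⁻¹ = -solHeight R x := rfl
    rcases hx with hx | hx
    · rcases key _ hx with h | h
      · exact Or.inl h
      · exact Or.inr (Or.inl h)
    · rcases key _ hx with h | ⟨h, h'⟩
      · exact Or.inl (by omega)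
      · exact Or.inr (Or.inr ⟨by rw [← h, inv_inv], by omega⟩)
  comm x y hx hy := by
    rw [eq_solInl_mul_zpow R x, eq_solInl_mul_zpow R y, hx, hy, zpow_zero, mul_one, mul_one,
      ← solInl_add, ← solInl_add, add_comm]

/-- This is the twisted additivity required of `Φ` in the height estimates. -/
theorem map_left_mul {φ : (Fin 2 → ℤ) →+ ℂ} {z : ℂ} (hz : z ≠ 0) (hφ : ∀ v, φ (R v) = z * φ v)
    (x y : SolGroup R) :
    φ (x * y).left.toAdd = φ x.left.toAdd + z ^ solHeight R x * φ y.left.toAdd := by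
  have key (n : ℤ) (w : Multiplicative (Fin 2 → ℤ)) :
      φ (Multiplicative.toAdd ((AddEquiv.toMultiplicative R ^ n : MulAut _) w)) =
        z ^ n * φ w.toAdd := by
    induction n generalizing w with
    | zero => simp
    | succ n ih =>
      rw [zpow_add_one, MulAut.mul_apply, ih, zpow_add_one₀ hz, mul_assoc]
      congr 1
      exact hφ _
    | pred n ih =>
      obtain ⟨u, rfl⟩ := (AddEquiv.toMultiplicative R).surjective w
      have hu : φ (Multiplicative.toAdd (AddEquiv.toMultiplicative R u)) = z * φ u.toAdd := hφ _
      rw [zpow_sub_one, MulAut.mul_apply, MulAut.inv_apply_self, ih, hu, zpow_sub_one₀ hz]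
      field_simp
  rw [SemidirectProduct.mul_left, toAdd_mul, map_add]
  exact congrArg (φ x.left.toAdd + ·) (key _ _)

variable {R}

theorem norm_map_letter_le {φ : (Fin 2 → ℤ) →+ ℂ} :
    ∃ K : ℝ, 0 < K ∧ ∀ x : SolGroup R, x ∈ solGens R ∨ x⁻¹ ∈ solGens R →
      ‖φ x.left.toAdd‖ ≤ K := by
  have hX : {x : SolGroup R | x ∈ solGens R ∨ x⁻¹ ∈ solGens R}.Finite :=
    (Set.toFinite (solGens R)).union ((Set.toFinite (solGens R)).preimage inv_injective.injOn)
  obtain ⟨K, hK⟩ := (hX.image fun x => ‖φ x.left.toAdd‖).bddAbove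
  exact ⟨max K 1, by positivity, fun x hx => (hK ⟨x, hx, rfl⟩).trans (le_max_left _ _)⟩

/-- Some translates of arbitrarily large balls of `ℤ²` consist of elements from which moving up or
down by at most `n` does not increase the word length. -/
theorem IsHyperbolicAut.exists_wordLength_mul_zpow_le (hR : IsHyperbolicAut R) (n : ℕ) (M : ℝ) :
    ∃ v, ∀ u : Fin 2 → ℤ, ‖u‖ ≤ M → ∀ j : ℤ, |j| ≤ n →
      wordLength (solGens R) (solInl R (v + u) * solC R ^ j) ≤
        wordLength (solGens R) (solInl R (v + u)) := by
  obtain ⟨z, w, hz, hw, hw0, hzr, hwr⟩ := hR.exists_roots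
  obtain ⟨φ, hφ0, hφ⟩ := exists_eigenfunctional R hzr
  obtain ⟨ψ, hψ0, hψ⟩ := exists_eigenfunctional R hwr
  obtain ⟨v₀, hv₀, hv₀'⟩ := exists_ne_zero_of_ne_zero hφ0 hψ0
  obtain ⟨K, hK, hKφ⟩ := norm_map_letter_le (R := R) (φ := φ)
  obtain ⟨L, hL, hLψ⟩ := norm_map_letter_le (R := R) (φ := ψ)
  have hz0 : z ≠ 0 := norm_pos_iff.1 (by linarith)
  have hw1 : 1 ≤ ‖w⁻¹‖ := by
    rw [norm_inv]
    exact (one_le_inv₀ (norm_pos_iff.2 hw0)).2 hw.le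
  have hS := closure_solGens R
  have hp := isHeight_solHeight R
  obtain ⟨t, ht₁, ht₂⟩ := ((hR.eventually_wordLength_mul_lt hv₀
    (show 0 < ‖z‖ ^ n * K by positivity)).and (hR.eventually_wordLength_mul_lt hv₀'
    (show 0 < ‖w⁻¹‖ ^ n * L by positivity))).exists
  refine ⟨t • v₀, fun u hu j hj => ?_⟩
  obtain ⟨i, rfl | rfl⟩ := j.eq_nat_or_neg
  · rw [zpow_natCast]
    exact hp.wordLength_mul_pow_le_of_lt_norm hS (Φ := fun x => φ x.left.toAdd) hz.le
      (map_left_mul R hz0 hφ) hKφ rfl rfl (by simpa using hj) (ht₁ u hu)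
  · rw [zpow_neg, zpow_natCast, ← inv_pow]
    -- Reversing the height replaces the contracting eigenvalue `w` by `w⁻¹`, which expands.
    refine hp.neg.wordLength_mul_pow_le_of_lt_norm hS (Φ := fun x => ψ x.left.toAdd) hw1
      (fun x y => ?_) hLψ rfl rfl (by simpa using hj) (ht₂ u hu)
    rw [inv_zpow, ← zpow_neg, neg_neg]
    exact map_left_mul R hw0 hψ x y

variable (R) in
theorem exists_norm_left_le (n : ℕ) :
    ∃ D : ℝ, 0 ≤ D ∧ ∀ w : SolGroup R, wordLength (solGens R) w ≤ n → ‖w.left.toAdd‖ ≤ D := by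
  obtain ⟨D, hD⟩ := ((finite_setOf_wordLength_le (closure_solGens R) (Set.toFinite _) n).image
    fun x => ‖x.left.toAdd‖).bddAbove
  exact ⟨max D 0, le_max_right _ _, fun x hx => (hD ⟨x, hx, rfl⟩).trans (le_max_left _ _)⟩

/-! ### The climbing argument and the dead ends. -/

/-- Every word of length at most `n` can be appended to some element without increasing its
length. -/
theorem IsHyperbolicAut.exists_forall_wordLength_mul_le (hR : IsHyperbolicAut R) (n : ℕ) :
    ∃ g : SolGroup R, ∀ w, wordLength (solGens R) w ≤ n →
      wordLength (solGens R) (g * w) ≤ wordLength (solGens R) g := by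
  obtain ⟨D, hD0, hD⟩ := exists_norm_left_le R n
  -- A displacement of norm at most `N * D` then has length at most `N / 2 + C`, which is below `N`
  -- once `2 * C < N`.
  obtain ⟨C, hC⟩ := hR.exists_wordLength_solInl_le (show 0 < 1 / (2 * (D + 1)) by positivity)
  obtain ⟨N, hN⟩ := exists_nat_gt (max (2 * C) 0)
  have hNC : 2 * C < N := (le_max_left _ _).trans_lt hN
  have hN0 : (0 : ℝ) < N := (le_max_right _ _).trans_lt hN
  obtain ⟨v, hv⟩ := hR.exists_wordLength_mul_zpow_le n (N * D)
  by_contra! hcon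
  have climb (k : ℕ) (hk : k ≤ N) : ∃ u : Fin 2 → ℤ, ‖u‖ ≤ k * D ∧
      wordLength (solGens R) (solInl R v) + k ≤ wordLength (solGens R) (solInl R (v + u)) := by
    induction k with
    | zero => exact ⟨0, by simp, by simp⟩
    | succ k ih =>
      obtain ⟨u, hu, hle⟩ := ih (by omega)
      obtain ⟨w, hw, hlt⟩ := hcon (solInl R (v + u))
      have hn : ‖u + w.left.toAdd‖ ≤ (k + 1 : ℕ) * D := by
        refine (norm_add_le _ _).trans ?_
        have := hD w hw
        push_cast
        linarith
      refine ⟨u + w.left.toAdd, hn, ?_⟩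
      have hj : |solHeight R w| ≤ n :=
        ((isHeight_solHeight R).abs_le_wordLength (closure_solGens R) w).trans (by exact_mod_cast hw)
      -- Removing the height of `solInl R (v + u) * w` does not shorten it, so the gain in length
      -- survives the return to `ℤ²`.
      have h := hv _ (hn.trans (by gcongr)) _ hj
      rw [← add_assoc, solInl_add R (v + u), mul_assoc, ← eq_solInl_mul_zpow, ← solInl_add,
        add_assoc] at h
      omega
  obtain ⟨u, hu, hle⟩ := climb N le_rfl
  have h₁ := wordLength_solInl_add_le R v u
  have h₂ : (N : ℝ) ≤ wordLength (solGens R) (solInl R u) := by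
    exact_mod_cast (by omega : N ≤ wordLength (solGens R) (solInl R u))
  have h₃ : 1 / (2 * (D + 1)) * ‖u‖ ≤ N / 2 := by
    rw [one_div_mul_eq_div, div_le_div_iff₀ (by positivity) two_pos]
    nlinarith
  linarith [hC u]

theorem exists_wordLength_lt (g : SolGroup R) :
    ∃ h, wordLength (solGens R) g < wordLength (solGens R) h := by
  refine ⟨solC R ^ ((wordLength (solGens R) g + 1 : ℕ) : ℤ), ?_⟩
  have h := (isHeight_solHeight R).abs_le_wordLength (closure_solGens R)
    (solC R ^ ((wordLength (solGens R) g + 1 : ℕ) : ℤ))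
  nth_rewrite 1 [solC_zpow] at h
  change |((wordLength (solGens R) g + 1 : ℕ) : ℤ)| ≤ _ at h
  rw [Nat.abs_cast] at h
  omega

end Sol

theorem proposition4 (R : AddAut (Fin 2 → ℤ)) (hR : IsHyperbolicAut R) :
    Subgroup.closure ({solA R, solB R, solC R} : Set (SolGroup R)) = ⊤ ∧
    ∀ n : ℕ, ∃ g : SolGroup R,
      IsDeadEnd {solA R, solB R, solC R} g ∧ n ≤ deadEndDepth {solA R, solB R, solC R} g := by
  refine ⟨closure_solGens R, fun n => ?_⟩
  -- Using `n + 1` gives depth at least `n + 2`, which exceeds `1` even for `n = 0`.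
  obtain ⟨g, hg⟩ := hR.exists_forall_wordLength_mul_le (n + 1)
  have h : n + 2 ≤ deadEndDepth (solGens R) g := by
    refine le_deadEndDepth (exists_wordLength_lt g) fun w hw => ?_
    by_contra! hlt
    exact hw.not_ge (hg w (by omega))
  exact ⟨g, lt_of_lt_of_le (by omega) h, le_trans (by omega) h⟩
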